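/- Let $n,m\ge 0$ be integers, let $A\in\mathbb R^{n\times n}$, $B\in\mathbb R^{n\times m}$, and let $S\in\mathbb R^{n\times n}$, $R\in\mathbb R^{m\times m}$ be symmetric positive definite. Let $\rho(\cdot)$ denote the spectral radius and $\|\cdot\|_2$ the spectral norm of matrices. Assume that $(A,B)$ is stabilizable, i.e. $\rho(A-BK)<1$ for some $K\in\mathbb R^{m\times n}$. Define $$\mathcal R(P,S)=A^\top PA-A^\top PB\,(R+B^\top PB)^{-1}B^\top PA+S .$$ Then there is a unique symmetric positive definite matrix $P^*$ with $P^*=\mathcal R(P^*,S)$, and with $K^*=(R+B^\top P^*B)^{-1}B^\top P^*A$ one has $\rho(A-BK^*)<1$. Exact value iteration, i.e. $P_{i+1}=\mathcal R(P_i,S)$ for $i\ge 0$ with $P_0$ symmetric positive semidefinite, is globally exponentially stable on the positive semidefinite cone: $\mathcal R(\cdot,S)$ maps this cone to itself and there are $a>0$ and $b\in(0,1)$ such that $\|P_i-P^*\|_2\le a\,b^i\,\|P_0-P^*\|_2$ for all symmetric positive semidefinite $P_0$ and all $i\ge 0$. More precisely, for every $\theta\in(\rho(A-BK^*),1)$ there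 is a constant $\alpha\ge 1$ such that $\beta(r,i)=\alpha\,\theta^{2i}\,r$ $(r\ge 0,\ i\in\mathbb Z_{\ge 0})$ satisfies $$\|P_i-P^*\|_2\le \beta(\|P_0-P^*\|_2,\,i)=\alpha\,\theta^{2i}\,\|P_0-P^*\|_2$$ for all symmetric positive semidefinite $P_0$ and all $i\ge 0$. Moreover, $\beta$ is a $\mathcal{KL}$-function: for each $i$, $\beta(\cdot,i)$ is continuous, strictly increasing and vanishes at $0$, and for each $r$, $\beta(r,i)$ is nonincreasing in $i$ and tends to $0$ as $i\to\infty$. -/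

import Mathlib

open Filter Topology
open scoped NNReal ENNReal Matrix Matrix.Norms.L2Operator

/-- The spectral radius `ρ(M)` of a real square matrix: the largest modulus of its complex
eigenvalues. -/
noncomputable def specRad {n : ℕ} (M : Matrix (Fin n) (Fin n) ℝ) : ℝ≥0∞ :=
  spectralRadius ℂ (M.map (algebraMap ℝ ℂ))

/-- `(A, B)` is stabilizable: some static feedback gain makes the closed loop Schur stable. -/
def Stabilizable {n m : ℕ} (A : Matrix (Fin n) (Fin n) ℝ) (B : Matrix (Fin n) (Fin m) ℝ) : Prop :=
  ∃ K : Matrix (Fin m) (Fin n) ℝ, specRad (A - B * K) < 1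

/-- The control gain `K_P = (R + Bᵀ P B)⁻¹ Bᵀ P A` induced by the value matrix `P`. -/
noncomputable def gain {n m : ℕ} (A : Matrix (Fin n) (Fin n) ℝ) (B : Matrix (Fin n) (Fin m) ℝ)
    (R : Matrix (Fin m) (Fin m) ℝ) (P : Matrix (Fin n) (Fin n) ℝ) : Matrix (Fin m) (Fin n) ℝ :=
  (R + Bᵀ * P * B)⁻¹ * Bᵀ * P * A

/-- The Riccati operator `𝓡(P, S) = Aᵀ P A - Aᵀ P B (R + Bᵀ P B)⁻¹ Bᵀ P A + S`. -/
noncomputable def riccati {n m : ℕ} (A : Matrix (Fin n) (Fin n) ℝ) (B : Matrix (Fin n) (Fin m) ℝ)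
    (R : Matrix (Fin m) (Fin m) ℝ) (P S : Matrix (Fin n) (Fin n) ℝ) : Matrix (Fin n) (Fin n) ℝ :=
  Aᵀ * P * A - Aᵀ * P * B * (R + Bᵀ * P * B)⁻¹ * Bᵀ * P * A + S

/-- `P` is a sequence produced by exact value iteration, started at a positive semidefinite
matrix. -/
def IsExactVI {n m : ℕ} (A : Matrix (Fin n) (Fin n) ℝ) (B : Matrix (Fin n) (Fin m) ℝ)
    (S : Matrix (Fin n) (Fin n) ℝ) (R : Matrix (Fin m) (Fin m) ℝ)
    (P : ℕ → Matrix (Fin n) (Fin n) ℝ) : Prop :=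
  (P 0).PosSemidef ∧ ∀ i, P (i + 1) = riccati A B R (P i) S

/-- Class `𝒦` functions. -/
def IsClassK (γ : ℝ≥0 → ℝ≥0) : Prop :=
  Continuous γ ∧ StrictMono γ ∧ γ 0 = 0

/-- Class `𝒦ℒ` functions, with discrete time as second argument. -/
def IsClassKL (β : ℝ≥0 → ℕ → ℝ≥0) : Prop :=
  (∀ i, IsClassK fun r => β r i) ∧ ∀ r, Antitone (β r) ∧ Tendsto (β r) atTop (𝓝 0)

/-- `x` is a globally exponentially stable equilibrium of the discrete-time system
`x_{i+1} = f(x_i)` with state space `D`. -/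
def GloballyExpStable {E : Type*} [NormedAddCommGroup E] (f : E → E) (D : Set E) (x : E) : Prop :=
  Set.MapsTo f D D ∧ x ∈ D ∧ f x = x ∧
    ∃ a b : ℝ, 0 < a ∧ 0 < b ∧ b < 1 ∧ ∀ y ∈ D, ∀ i : ℕ, ‖f^[i] y - x‖ ≤ a * b ^ i * ‖y - x‖

/-! Everything is done with quadratic forms, so that `≤` between symmetric matrices means `≤` of
their forms. Completing the square (`riccati_complete_square`) gives the Bellman form f(P)(x) = min
over u of P(Ax - Bu) + R(u) + S(x), attained at u = K_P x. Trial inputs then give monotonicity and,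
since S > 0, the gain in `riccati_concave`: (1-t)Q ≤ P implies (1-t) f(Q) + tS ≤ f(P).

Existence: the iterates from 0 increase and are bounded by the cost of a stabilizing feedback. The
gain makes them geometrically Cauchy, and their limit P is a fixed point with P ≥ S > 0. The
equation P(x) = P(Fx) + R(K_P x) + S(x), with F = A - B K_P, makes P a Lyapunov function for F.

Convergence: using the gain K_P for every iterate gives fⁱ(Q) - P ≤ (Fⁱ)ᵀ (Q - P) Fⁱ. For the lower
side, Q dominates some (1-γ)P with γ = O(‖Q - P‖). Started there, each step carries the error along
F up to a factor (1 - κδⁱ)⁻¹ (`quadForm_sub_riccati_le`). The product of these factors converges, so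
only a constant is lost and the rate stays that of F. Gelfand's formula bounds ‖Fⁱ‖ by c θⁱ, and
uniqueness follows from convergence. -/

/-- The quadratic form `x ↦ xᵀ P x` of a real square matrix. -/
def Matrix.quadForm {n : ℕ} (P : Matrix (Fin n) (Fin n) ℝ) (x : Fin n → ℝ) : ℝ :=
  x ⬝ᵥ P *ᵥ x

/-! ### Quadratic forms, the spectral norm and coercivity. -/

namespace Matrix

variable {n m : ℕ} {P Q : Matrix (Fin n) (Fin n) ℝ}

theorem quadForm_add (P Q : Matrix (Fin n) (Fin n) ℝ) (x : Fin n → ℝ) :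
    (P + Q).quadForm x = P.quadForm x + Q.quadForm x := by
  simp [quadForm, add_mulVec]

theorem quadForm_sub (P Q : Matrix (Fin n) (Fin n) ℝ) (x : Fin n → ℝ) :
    (P - Q).quadForm x = P.quadForm x - Q.quadForm x := by
  simp [quadForm, sub_mulVec]

theorem quadForm_smul (c : ℝ) (P : Matrix (Fin n) (Fin n) ℝ) (x : Fin n → ℝ) :
    (c • P).quadForm x = c * P.quadForm x := by
  simp [quadForm, smul_mulVec]

@[simp]
theorem quadForm_zero (x : Fin n → ℝ) : (0 : Matrix (Fin n) (Fin n) ℝ).quadForm x = 0 := by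
  simp [quadForm]

theorem quadForm_conj (P : Matrix (Fin n) (Fin n) ℝ) (M : Matrix (Fin n) (Fin m) ℝ)
    (x : Fin m → ℝ) : (Mᵀ * P * M).quadForm x = P.quadForm (M *ᵥ x) := by
  simp only [quadForm, ← mulVec_mulVec]
  rw [mulVec_transpose, dotProduct_comm, ← dotProduct_mulVec, dotProduct_comm]

theorem quadForm_smul_vec (P : Matrix (Fin n) (Fin n) ℝ) (c : ℝ) (x : Fin n → ℝ) :
    P.quadForm (c • x) = c ^ 2 * P.quadForm x := by
  simp [quadForm, mulVec_smul]; ring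

theorem IsHermitian.dotProduct_mulVec_comm (hP : P.IsHermitian) (x y : Fin n → ℝ) :
    x ⬝ᵥ P *ᵥ y = y ⬝ᵥ P *ᵥ x := by
  have hP' : Pᵀ = P := by simpa [conjTranspose_eq_transpose_of_trivial] using hP.eq
  rw [dotProduct_comm, ← vecMul_transpose, hP', ← dotProduct_mulVec]

theorem IsHermitian.quadForm_add_vec (hP : P.IsHermitian) (x y : Fin n → ℝ) :
    P.quadForm (x + y) = P.quadForm x + 2 * (y ⬝ᵥ P *ᵥ x) + P.quadForm y := by
  have := hP.dotProduct_mulVec_comm x y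
  simp only [quadForm, mulVec_add, add_dotProduct, dotProduct_add]
  linarith

theorem IsHermitian.quadForm_sub_vec (hP : P.IsHermitian) (x y : Fin n → ℝ) :
    P.quadForm (x - y) = P.quadForm x - 2 * (y ⬝ᵥ P *ᵥ x) + P.quadForm y := by
  have := hP.dotProduct_mulVec_comm x y
  simp only [quadForm, mulVec_sub, sub_dotProduct, dotProduct_sub]
  linarith

theorem PosSemidef.quadForm_nonneg (hP : P.PosSemidef) (x : Fin n → ℝ) : 0 ≤ P.quadForm x := by
  simpa [quadForm] using hP.dotProduct_mulVec_nonneg x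

theorem PosDef.quadForm_pos (hP : P.PosDef) {x : Fin n → ℝ} (hx : x ≠ 0) :
    0 < P.quadForm x := by
  simpa [quadForm] using hP.dotProduct_mulVec_pos hx

theorem IsHermitian.posSemidef_of_quadForm (hP : P.IsHermitian) (h : ∀ x, 0 ≤ P.quadForm x) :
    P.PosSemidef :=
  .of_dotProduct_mulVec_nonneg hP fun x => by simpa [quadForm] using h x

theorem IsHermitian.posDef_of_quadForm_le (hP : P.IsHermitian) (hQ : Q.PosDef)
    (h : ∀ x, Q.quadForm x ≤ P.quadForm x) : P.PosDef :=
  .of_dotProduct_mulVec_pos hP fun x hx => by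
    simpa [quadForm] using (hQ.quadForm_pos hx).trans_le (h x)

/-- Young's inequality for a positive semidefinite quadratic form. -/
theorem PosSemidef.quadForm_sub_vec_le (hP : P.PosSemidef) {s : ℝ} (hs : 0 < s)
    (x y : Fin n → ℝ) :
    P.quadForm (x - y) ≤ (1 + s) * P.quadForm x + (1 + s⁻¹) * P.quadForm y := by
  have h := hP.quadForm_nonneg (s • x + y)
  rw [hP.1.quadForm_add_vec, quadForm_smul_vec, mulVec_smul, dotProduct_smul, smul_eq_mul] at h
  rw [hP.1.quadForm_sub_vec]
  have h2 : s⁻¹ * (s ^ 2 * P.quadForm x + 2 * (s * (y ⬝ᵥ P *ᵥ x)) + P.quadForm y)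
      = s * P.quadForm x + 2 * (y ⬝ᵥ P *ᵥ x) + s⁻¹ * P.quadForm y := by
    field_simp
  have h3 := mul_nonneg (inv_nonneg.2 hs.le) h
  rw [h2] at h3
  linarith

theorem dotProduct_self_eq_norm_sq (x : Fin n → ℝ) : x ⬝ᵥ x = ‖WithLp.toLp 2 x‖ ^ 2 := by
  rw [EuclideanSpace.real_norm_sq_eq]
  simp [dotProduct, sq]

theorem dotProduct_self_nonneg (x : Fin n → ℝ) : 0 ≤ x ⬝ᵥ x := by
  rw [dotProduct_self_eq_norm_sq]
  positivity

theorem norm_toLp_mulVec_le (M : Matrix (Fin m) (Fin n) ℝ) (x : Fin n → ℝ) :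
    ‖WithLp.toLp 2 (M *ᵥ x)‖ ≤ ‖M‖ * ‖WithLp.toLp 2 x‖ :=
  l2_opNorm_mulVec M (WithLp.toLp 2 x)

theorem mulVec_dotProduct_self_le (M : Matrix (Fin m) (Fin n) ℝ) (x : Fin n → ℝ) :
    M *ᵥ x ⬝ᵥ M *ᵥ x ≤ ‖M‖ ^ 2 * (x ⬝ᵥ x) := by
  rw [dotProduct_self_eq_norm_sq, dotProduct_self_eq_norm_sq, ← mul_pow]
  exact pow_le_pow_left₀ (norm_nonneg _) (norm_toLp_mulVec_le M x) 2

theorem l2_opNorm_le_of_mulVec {M : Matrix (Fin m) (Fin n) ℝ} {c : ℝ} (hc : 0 ≤ c)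
    (h : ∀ x : Fin n → ℝ, ‖WithLp.toLp 2 (M *ᵥ x)‖ ≤ c * ‖WithLp.toLp 2 x‖) : ‖M‖ ≤ c := by
  rw [l2_opNorm_def]
  exact ContinuousLinearMap.opNorm_le_bound _ hc fun x => h x.ofLp

theorem abs_quadForm_le (P : Matrix (Fin n) (Fin n) ℝ) (x : Fin n → ℝ) :
    |P.quadForm x| ≤ ‖P‖ * (x ⬝ᵥ x) := by
  have h := abs_real_inner_le_norm (WithLp.toLp 2 (P *ᵥ x)) (WithLp.toLp 2 x)
  rw [EuclideanSpace.inner_toLp_toLp, star_trivial] at h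
  rw [quadForm, dotProduct_self_eq_norm_sq]
  nlinarith [norm_toLp_mulVec_le P x, norm_nonneg (WithLp.toLp 2 x)]

theorem quadForm_le_norm (P : Matrix (Fin n) (Fin n) ℝ) (x : Fin n → ℝ) :
    P.quadForm x ≤ ‖P‖ * (x ⬝ᵥ x) :=
  (le_abs_self _).trans (abs_quadForm_le P x)

/-- The spectral norm of a symmetric matrix is bounded by any bound of its quadratic form. -/
theorem IsHermitian.l2_opNorm_le (hP : P.IsHermitian) {c : ℝ} (hc : 0 ≤ c)
    (h : ∀ x, |P.quadForm x| ≤ c * (x ⬝ᵥ x)) : ‖P‖ ≤ c := by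
  refine l2_opNorm_le_of_mulVec hc fun x => ?_
  set N := ‖WithLp.toLp 2 (P *ᵥ x)‖ with hN
  set X := ‖WithLp.toLp 2 x‖ with hX
  have hN0 : 0 ≤ N := norm_nonneg _
  have hX0 : 0 ≤ X := norm_nonneg _
  -- Polarization with y = Px: the forms at x + sy and x - sy differ by 4s|y|². The choice s = X / N
  -- below balances the two terms on the right.
  have key : ∀ s : ℝ, 2 * s * N ^ 2 ≤ c * (X ^ 2 + s ^ 2 * N ^ 2) := by
    intro s
    have h1 := (abs_le.1 (h (x + s • (P *ᵥ x)))).2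
    have h2 := (abs_le.1 (h (x - s • (P *ᵥ x)))).1
    rw [hP.quadForm_add_vec] at h1
    rw [hP.quadForm_sub_vec] at h2
    simp only [smul_dotProduct, dotProduct_smul, add_dotProduct, dotProduct_add, sub_dotProduct,
      dotProduct_sub, smul_eq_mul, dotProduct_comm (P *ᵥ x) x] at h1 h2
    rw [dotProduct_self_eq_norm_sq x, dotProduct_self_eq_norm_sq (P *ᵥ x), ← hN, ← hX] at h1 h2
    nlinarith
  rcases hN0.eq_or_lt with h0 | h0
  · rw [← h0]; positivity
  have k := key (X / N)
  have e : (X / N) ^ 2 * N ^ 2 = X ^ 2 := by field_simp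
  have e' : 2 * (X / N) * N ^ 2 = 2 * X * N := by field_simp
  rw [e, e'] at k
  rcases hX0.eq_or_lt with h1 | h1
  · have k := key 1
    have k2 := norm_toLp_mulVec_le P x
    rw [← hX, ← h1, mul_zero] at k2
    linarith
  · exact le_of_mul_le_mul_left (by nlinarith : X * N ≤ X * (c * X)) h1

theorem l2_opNorm_sq_le_of_quadForm {M : Matrix (Fin m) (Fin n) ℝ} {c : ℝ} (hc : 0 ≤ c)
    (h : ∀ x : Fin n → ℝ, M *ᵥ x ⬝ᵥ M *ᵥ x ≤ c * (x ⬝ᵥ x)) : ‖M‖ ^ 2 ≤ c := by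
  rw [← Real.le_sqrt (norm_nonneg _) hc]
  refine l2_opNorm_le_of_mulVec (Real.sqrt_nonneg _) fun x => ?_
  have := h x
  rw [dotProduct_self_eq_norm_sq, dotProduct_self_eq_norm_sq] at this
  refine abs_le_of_sq_le_sq' ?_ (by positivity) |>.2
  rw [mul_pow, Real.sq_sqrt hc]
  exact this

/-- A positive definite quadratic form is coercive. -/
theorem PosDef.exists_quadForm_ge (hP : P.PosDef) :
    ∃ c : ℝ, 0 < c ∧ ∀ x, c * (x ⬝ᵥ x) ≤ P.quadForm x := by
  have hcont : Continuous fun x : EuclideanSpace ℝ (Fin n) => P.quadForm x.ofLp := by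
    unfold quadForm; fun_prop
  -- The unit sphere is empty when n = 0; otherwise the minimum of the form on it is the constant.
  rcases (Metric.sphere (0 : EuclideanSpace ℝ (Fin n)) 1).eq_empty_or_nonempty with he | hne
  · refine ⟨1, one_pos, fun x => ?_⟩
    have : x = 0 := by
      by_contra hx
      have hx' : WithLp.toLp 2 x ≠ 0 := by simpa using hx
      have : ‖WithLp.toLp 2 x‖⁻¹ • WithLp.toLp 2 x ∈
          Metric.sphere (0 : EuclideanSpace ℝ (Fin n)) 1 := by
        simp [norm_smul, hx']
      simp [he] at this
    simp [this, quadForm]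
  obtain ⟨z, hz, hmin⟩ := (isCompact_sphere (0 : EuclideanSpace ℝ (Fin n)) 1).exists_isMinOn hne
    hcont.continuousOn
  have hz0 : z.ofLp ≠ 0 := by
    rintro h
    have : z = 0 := by ext i; simp [h]
    simp [this] at hz
  refine ⟨_, hP.quadForm_pos hz0, fun x => ?_⟩
  by_cases hx : x = 0
  · simp [hx, quadForm]
  have hx' : WithLp.toLp 2 x ≠ 0 := by simpa using hx
  have hmem : ‖WithLp.toLp 2 x‖⁻¹ • WithLp.toLp 2 x ∈
      Metric.sphere (0 : EuclideanSpace ℝ (Fin n)) 1 := by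
    simp [norm_smul, hx']
  have h := hmin hmem
  simp only [Set.mem_ofPred_eq, WithLp.ofLp_smul, quadForm_smul_vec] at h
  rw [dotProduct_self_eq_norm_sq]
  have hpos : 0 < ‖WithLp.toLp 2 x‖ := norm_pos_iff.2 hx'
  calc _ ≤ (‖WithLp.toLp 2 x‖⁻¹ ^ 2 * P.quadForm x) * ‖WithLp.toLp 2 x‖ ^ 2 := by gcongr
    _ = _ := by field_simp

/-- A positive definite `Q` dominates a fixed positive fraction of every matrix `P` of norm at most
`M`. -/
theorem PosDef.exists_contraction (hQ : Q.PosDef) (M : ℝ) :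
    ∃ κ : ℝ, 0 < κ ∧ κ < 1 ∧ ∀ P : Matrix (Fin n) (Fin n) ℝ, ‖P‖ ≤ M →
      ∀ x, (1 - κ) * P.quadForm x ≤ Q.quadForm x := by
  obtain ⟨c, hc, h⟩ := hQ.exists_quadForm_ge
  have hM : 0 < |M| + c + 1 := by positivity
  have hc1 : c / (|M| + c + 1) < 1 := by rw [div_lt_one hM]; linarith [abs_nonneg M]
  have hc0 : 0 < c / (|M| + c + 1) := by positivity
  -- With c the coercivity constant of Q, the ratio c / M would do; enlarging the denominator keeps
  -- 1 - κ strictly between 0 and 1 for every real M.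
  refine ⟨1 - c / (|M| + c + 1), by linarith, by linarith, fun P hP x => ?_⟩
  have hx := dotProduct_self_nonneg x
  refine le_trans ?_ (h x)
  calc _ = c / (|M| + c + 1) * P.quadForm x := by ring
    _ ≤ c / (|M| + c + 1) * (‖P‖ * (x ⬝ᵥ x)) := by gcongr; exact quadForm_le_norm P x
    _ ≤ c / (|M| + c + 1) * ((|M| + c + 1) * (x ⬝ᵥ x)) := by
      gcongr; linarith [le_abs_self M]
    _ = _ := by field_simp

end Matrix

open Matrix

/-! ### The Riccati operator as a minimum over inputs: order properties and continuity. -/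

section Riccati

variable {n m : ℕ} {A : Matrix (Fin n) (Fin n) ℝ} {B : Matrix (Fin n) (Fin m) ℝ}
  {S : Matrix (Fin n) (Fin n) ℝ} {R : Matrix (Fin m) (Fin m) ℝ} {P Q : Matrix (Fin n) (Fin n) ℝ}

theorem Matrix.PosSemidef.transpose_mul_mul_same (hP : P.PosSemidef)
    (M : Matrix (Fin n) (Fin m) ℝ) : (Mᵀ * P * M).PosSemidef := by
  simpa [conjTranspose_eq_transpose_of_trivial] using hP.conjTranspose_mul_mul_same M

theorem Matrix.PosDef.add_transpose_mul_mul (hR : R.PosDef) (hP : P.PosSemidef) :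
    (R + Bᵀ * P * B).PosDef :=
  hR.add_posSemidef (hP.transpose_mul_mul_same B)

theorem riccati_isHermitian (hS : S.IsHermitian) (hR : R.IsHermitian) (hP : P.IsHermitian) :
    (riccati A B R P S).IsHermitian := by
  simp only [IsHermitian, conjTranspose_eq_transpose_of_trivial] at *
  simp [riccati, transpose_mul, transpose_nonsing_inv, hS, hR, hP, Matrix.mul_assoc]

/-- Completion of squares: the cost-to-go of the input `-u` exceeds the optimal one by a quadratic
form in `u - K_P x`. -/
theorem riccati_complete_square (hR : R.PosDef) (hP : P.PosSemidef) (x : Fin n → ℝ)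
    (u : Fin m → ℝ) :
    P.quadForm (A *ᵥ x - B *ᵥ u) + R.quadForm u + S.quadForm x =
      (riccati A B R P S).quadForm x
        + (R + Bᵀ * P * B).quadForm (u - gain A B R P *ᵥ x) := by
  have hW := hR.add_transpose_mul_mul (B := B) hP
  have hdet : IsUnit (R + Bᵀ * P * B).det := (isUnit_iff_isUnit_det _).1 hW.isUnit
  set W := R + Bᵀ * P * B with hWdef
  -- The cost as a function of u is W(u) - 2 u·g plus terms free of u, so its minimizer is W⁻¹ g.
  set g : Fin m → ℝ := Bᵀ *ᵥ P *ᵥ A *ᵥ x with hg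
  have hgain : gain A B R P *ᵥ x = W⁻¹ *ᵥ g := by
    simp [gain, hg, ← mulVec_mulVec, ← hWdef]
  have hWg : W *ᵥ W⁻¹ *ᵥ g = g := by
    rw [mulVec_mulVec, mul_nonsing_inv _ hdet, one_mulVec]
  have hPt : Pᵀ = P := by simpa [conjTranspose_eq_transpose_of_trivial] using hP.1.eq
  have e1 : (riccati A B R P S).quadForm x
      = P.quadForm (A *ᵥ x) - g ⬝ᵥ W⁻¹ *ᵥ g + S.quadForm x := by
    rw [riccati, quadForm_add, quadForm_sub, quadForm_conj, ← hWdef]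
    congr 2
    simp only [quadForm, ← mulVec_mulVec, ← hg]
    rw [dotProduct_mulVec x Aᵀ, vecMul_transpose, dotProduct_mulVec _ P, ← mulVec_transpose, hPt,
      dotProduct_mulVec _ B, ← mulVec_transpose]
  have e2 : W.quadForm u = R.quadForm u + P.quadForm (B *ᵥ u) := by
    rw [hWdef, quadForm_add, quadForm_conj]
  have e3 : B *ᵥ u ⬝ᵥ P *ᵥ A *ᵥ x = u ⬝ᵥ g := by
    rw [hg, dotProduct_mulVec u Bᵀ, vecMul_transpose]
  have e4 : W.quadForm (W⁻¹ *ᵥ g) = g ⬝ᵥ W⁻¹ *ᵥ g := by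
    rw [quadForm, hWg, dotProduct_comm]
  have e5 : W⁻¹ *ᵥ g ⬝ᵥ W *ᵥ u = u ⬝ᵥ g := by
    rw [hW.1.dotProduct_mulVec_comm, hWg]
  rw [hgain, hP.1.quadForm_sub_vec, hW.1.quadForm_sub_vec, e1, e2, e3, e4, e5]
  ring

/-- Together with `riccati_quadForm_eq` this is the Bellman principle: any input gives an upper
bound, and the gain of P attains it. -/
theorem riccati_quadForm_le (hR : R.PosDef) (hP : P.PosSemidef) (x : Fin n → ℝ)
    (u : Fin m → ℝ) :
    (riccati A B R P S).quadForm x ≤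
      P.quadForm (A *ᵥ x - B *ᵥ u) + R.quadForm u + S.quadForm x := by
  rw [riccati_complete_square hR hP]
  have := (hR.add_transpose_mul_mul (B := B) hP).posSemidef.quadForm_nonneg
    (u - gain A B R P *ᵥ x)
  linarith

theorem riccati_quadForm_eq (hR : R.PosDef) (hP : P.PosSemidef) (x : Fin n → ℝ) :
    (riccati A B R P S).quadForm x =
      P.quadForm (A *ᵥ x - B *ᵥ gain A B R P *ᵥ x) + R.quadForm (gain A B R P *ᵥ x)
        + S.quadForm x := by
  rw [riccati_complete_square hR hP]
  simp [quadForm]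

theorem quadForm_le_riccati (hR : R.PosDef) (hP : P.PosSemidef) (x : Fin n → ℝ) :
    S.quadForm x ≤ (riccati A B R P S).quadForm x := by
  rw [riccati_quadForm_eq hR hP]
  have h1 := hP.quadForm_nonneg (A *ᵥ x - B *ᵥ gain A B R P *ᵥ x)
  have h2 := hR.posSemidef.quadForm_nonneg (gain A B R P *ᵥ x)
  linarith

theorem riccati_posSemidef (hS : S.PosDef) (hR : R.PosDef) (hP : P.PosSemidef) :
    (riccati A B R P S).PosSemidef :=
  (riccati_isHermitian hS.1 hR.1 hP.1).posSemidef_of_quadForm fun x =>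
    (hS.posSemidef.quadForm_nonneg x).trans (quadForm_le_riccati hR hP x)

/-- The Riccati operator is monotone and concave along rays through the origin. -/
theorem riccati_concave (hR : R.PosDef) (hP : P.PosSemidef)
    (hQ : Q.PosSemidef) {t : ℝ} (h0 : 0 ≤ t) (h1 : t ≤ 1)
    (h : ∀ x, (1 - t) * Q.quadForm x ≤ P.quadForm x) (x : Fin n → ℝ) :
    (1 - t) * (riccati A B R Q S).quadForm x + t * S.quadForm x ≤
      (riccati A B R P S).quadForm x := by
  rw [riccati_quadForm_eq hR hP]
  -- The input optimal for P serves as a trial input for Q.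
  set u := gain A B R P *ᵥ x
  have k1 := h (A *ᵥ x - B *ᵥ u)
  have k2 := mul_le_mul_of_nonneg_left (riccati_quadForm_le (S := S) (A := A) (B := B) hR hQ x u)
    (sub_nonneg.2 h1)
  have k3 := mul_nonneg h0 (hR.posSemidef.quadForm_nonneg u)
  linarith

theorem riccati_mono (hR : R.PosDef) (hP : P.PosSemidef) (hQ : Q.PosSemidef)
    (h : ∀ x, Q.quadForm x ≤ P.quadForm x) (x : Fin n → ℝ) :
    (riccati A B R Q S).quadForm x ≤ (riccati A B R P S).quadForm x := by
  simpa using riccati_concave (A := A) (B := B) (S := S) hR hP hQ le_rfl zero_le_one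
    (by simpa using h) x

/-- At a positive semidefinite P the matrix R + BᵀPB is invertible, and inversion is continuous at
units. This lets the limit of value iteration be identified as a fixed point. -/
theorem continuousAt_riccati (hR : R.PosDef) (hP : P.PosSemidef) :
    ContinuousAt (fun P => riccati A B R P S) P := by
  have hW := (hR.add_transpose_mul_mul (B := B) hP).isUnit
  have hinv : ContinuousAt (fun P : Matrix (Fin n) (Fin n) ℝ => (R + Bᵀ * P * B)⁻¹) P := by
    simp only [nonsing_inv_eq_ringInverse]
    have : CompleteSpace (Matrix (Fin m) (Fin m) ℝ) := FiniteDimensional.complete ℝ _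
    refine ContinuousAt.comp (g := Ring.inverse) (f := fun P : Matrix (Fin n) (Fin n) ℝ => R + Bᵀ * P * B) ?_ ?_
    · simpa using NormedRing.inverse_continuousAt hW.unit
    · exact Continuous.continuousAt (by fun_prop)
  have mul_left : ∀ {k l r : ℕ} (M : Matrix (Fin k) (Fin l) ℝ)
      {f : Matrix (Fin n) (Fin n) ℝ → Matrix (Fin l) (Fin r) ℝ}, ContinuousAt f P →
      ContinuousAt (fun X => M * f X) P := fun M f hf =>
    ContinuousAt.comp (g := fun Y => M * Y) (Continuous.continuousAt (by fun_prop)) hf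
  have hmul : ∀ {k l r : ℕ} {f : Matrix (Fin n) (Fin n) ℝ → Matrix (Fin k) (Fin l) ℝ}
      {g : Matrix (Fin n) (Fin n) ℝ → Matrix (Fin l) (Fin r) ℝ}, ContinuousAt f P →
      ContinuousAt g P → ContinuousAt (fun X => f X * g X) P := fun hf hg =>
    ContinuousAt.comp
      (g := fun Y : Matrix (Fin _) (Fin _) ℝ × Matrix (Fin _) (Fin _) ℝ => Y.1 * Y.2)
      (Continuous.continuousAt (by fun_prop)) (hf.prodMk hg)
  unfold riccati
  have c : ∀ {k l : ℕ} (M : Matrix (Fin k) (Fin l) ℝ),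
      ContinuousAt (fun _ : Matrix (Fin n) (Fin n) ℝ => M) P := fun M => continuousAt_const
  have i : ContinuousAt (fun X : Matrix (Fin n) (Fin n) ℝ => X) P := continuousAt_id
  exact ((hmul (hmul (c _) i) (c _)).sub
    (hmul (hmul (hmul (hmul (hmul (hmul (c _) i) (c _)) hinv) (c _)) i) (c _))).add (c _)

theorem continuous_quadForm (x : Fin n → ℝ) :
    Continuous fun P : Matrix (Fin n) (Fin n) ℝ => P.quadForm x := by
  unfold quadForm; fun_prop

theorem isClosed_posSemidef : IsClosed {P : Matrix (Fin n) (Fin n) ℝ | P.PosSemidef} := by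
  have : {P : Matrix (Fin n) (Fin n) ℝ | P.PosSemidef} =
      {P | Pᴴ = P} ∩ ⋂ x, {P | 0 ≤ P.quadForm x} := by
    ext P
    simp only [Set.mem_ofPred_eq, Set.mem_inter_iff, Set.mem_iInter]
    exact ⟨fun h => ⟨h.1, h.quadForm_nonneg⟩, fun h => IsHermitian.posSemidef_of_quadForm h.1 h.2⟩
  rw [this]
  exact (isClosed_eq (by fun_prop) continuous_id).inter
    (isClosed_iInter fun x => isClosed_le continuous_const (continuous_quadForm x))

end Riccati

/-! ### Spectral radius and growth of matrix powers. -/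

section SpecRad

variable {n : ℕ}

/-- Real vectors embed isometrically in the complex ones, where the complexified matrix acts as M.
This transfers complex power bounds back to M. -/
theorem norm_le_norm_map_ofReal (M : Matrix (Fin n) (Fin n) ℝ) :
    ‖M‖ ≤ ‖M.map (algebraMap ℝ ℂ)‖ := by
  have hnorm (y : Fin n → ℝ) :
      ‖WithLp.toLp 2 fun i => (y i : ℂ)‖ = ‖WithLp.toLp 2 y‖ := by
    simp [EuclideanSpace.norm_eq]
  refine l2_opNorm_le_of_mulVec (norm_nonneg _) fun x => ?_
  have h := l2_opNorm_mulVec (M.map (algebraMap ℝ ℂ)) (WithLp.toLp 2 fun i => (x i : ℂ))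
  have e : M.map (algebraMap ℝ ℂ) *ᵥ (fun i => (x i : ℂ)) = fun i => ((M *ᵥ x) i : ℂ) := by
    ext i
    simp [mulVec, dotProduct]
  rw [← hnorm x, ← hnorm (M *ᵥ x), ← e]
  exact h

theorem specRad_lt_one_of_tendsto {M : Matrix (Fin n) (Fin n) ℝ}
    (h : Tendsto (fun i => M ^ i) atTop (𝓝 0)) : specRad M < 1 := by
  have hc : Continuous fun X : Matrix (Fin n) (Fin n) ℝ => X.map (algebraMap ℝ ℂ) :=
    continuous_id.matrix_map (by simpa using Complex.continuous_ofReal)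
  have h1 : Tendsto (fun i => (M ^ i).map (algebraMap ℝ ℂ)) atTop (𝓝 0) := by
    have := (hc.tendsto 0).comp h
    simpa [Function.comp_def] using this
  -- The factor ‖1‖ and the exponent i + 1 match the bound ρ ≤ ‖M^(k+1)‖^(1/(k+1)) ‖1‖^(1/(k+1))
  -- used below.
  have h2 : Tendsto (fun i => ‖(M ^ (i + 1)).map (algebraMap ℝ ℂ)‖
      * ‖(1 : Matrix (Fin n) (Fin n) ℂ)‖) atTop (𝓝 0) := by
    have h3 := (h1.comp (tendsto_add_atTop_nat 1)).norm
    rw [norm_zero] at h3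
    simpa only [zero_mul, Function.comp_def] using
      Tendsto.mul_const ‖(1 : Matrix (Fin n) (Fin n) ℂ)‖ h3
  obtain ⟨k, hk⟩ := (h2.eventually_lt_const zero_lt_one).exists
  rw [Matrix.map_pow] at hk
  refine (spectrum.spectralRadius_le_pow_nnnorm_pow_one_div ℂ _ k).trans_lt ?_
  rw [← ENNReal.mul_rpow_of_nonneg _ _ (by positivity)]
  exact ENNReal.rpow_lt_one (by exact_mod_cast hk) (by positivity)

/-- By Gelfand's formula ‖Mⁱ‖ ≤ θⁱ for all large i; the finitely many remaining ratios ‖Mⁱ‖ / θⁱ are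
absorbed by adding them to the constant. -/
theorem exists_norm_pow_le_of_specRad_lt {M : Matrix (Fin n) (Fin n) ℝ} {θ : ℝ}
    (h : specRad M < ENNReal.ofReal θ) :
    ∃ c : ℝ, 1 ≤ c ∧ ∀ i : ℕ, ‖M ^ i‖ ≤ c * θ ^ i := by
  have hθ : 0 < θ := ENNReal.ofReal_pos.1 (bot_le.trans_lt h)
  have : CompleteSpace (Matrix (Fin n) (Fin n) ℂ) := FiniteDimensional.complete ℂ _
  have hG := spectrum.pow_nnnorm_pow_one_div_tendsto_nhds_spectralRadius
    (M.map (algebraMap ℝ ℂ))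
  have hev := hG.eventually_lt_const h
  obtain ⟨N, hN⟩ := eventually_atTop.1 hev
  have hlarge : ∀ i ≥ N + 1, ‖M ^ i‖ ≤ θ ^ i := by
    intro i hi
    refine (norm_le_norm_map_ofReal _).trans ?_
    have h1 := hN i (by omega)
    have hi0 : (i : ℝ) ≠ 0 := by norm_cast; omega
    have h2 := ENNReal.rpow_le_rpow h1.le (Nat.cast_nonneg i)
    rw [← ENNReal.rpow_mul, one_div, inv_mul_cancel₀ hi0, ENNReal.rpow_one,
      ENNReal.rpow_natCast, ← ENNReal.ofReal_pow hθ.le, ← Matrix.map_pow] at h2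
    rw [← enorm_eq_nnnorm, ← ofReal_norm, ENNReal.ofReal_le_ofReal_iff (by positivity)] at h2
    exact h2
  refine ⟨1 + ∑ i ∈ Finset.range (N + 1), ‖M ^ i‖ / θ ^ i, ?_, fun i => ?_⟩
  · have : 0 ≤ ∑ i ∈ Finset.range (N + 1), ‖M ^ i‖ / θ ^ i :=
      Finset.sum_nonneg fun i _ => by positivity
    linarith
  · have hs : 0 ≤ ∑ i ∈ Finset.range (N + 1), ‖M ^ i‖ / θ ^ i :=
      Finset.sum_nonneg fun i _ => by positivity
    rcases lt_or_ge i (N + 1) with hi | hi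
    · have := Finset.single_le_sum (f := fun i => ‖M ^ i‖ / θ ^ i) (fun i _ => by positivity)
        (Finset.mem_range.2 hi)
      have := (div_le_iff₀ (by positivity)).1 this
      refine this.trans ?_
      gcongr
      linarith
    · refine (hlarge i hi).trans ?_
      exact le_mul_of_one_le_left (by positivity) (by linarith)

end SpecRad

/-! ### Iterates of the operator and existence of a fixed point. -/

section ValueIteration

variable {n m : ℕ} {A : Matrix (Fin n) (Fin n) ℝ} {B : Matrix (Fin n) (Fin m) ℝ}
  {S : Matrix (Fin n) (Fin n) ℝ} {R : Matrix (Fin m) (Fin m) ℝ} {P Q : Matrix (Fin n) (Fin n) ℝ}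

theorem riccati_iterate_posSemidef (hS : S.PosDef) (hR : R.PosDef) (hP : P.PosSemidef) (i : ℕ) :
    ((fun P => riccati A B R P S)^[i] P).PosSemidef := by
  induction i with
  | zero => exact hP
  | succ i ih =>
    rw [Function.iterate_succ_apply']
    exact riccati_posSemidef hS hR ih

theorem riccati_iterate_mono (hS : S.PosDef) (hR : R.PosDef) (hP : P.PosSemidef)
    (hQ : Q.PosSemidef) (h : ∀ x, Q.quadForm x ≤ P.quadForm x) (i : ℕ) (x : Fin n → ℝ) :
    ((fun P => riccati A B R P S)^[i] Q).quadForm x ≤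
      ((fun P => riccati A B R P S)^[i] P).quadForm x := by
  induction i generalizing x with
  | zero => exact h x
  | succ i ih =>
    simp only [Function.iterate_succ_apply']
    exact riccati_mono hR (riccati_iterate_posSemidef hS hR hP i)
      (riccati_iterate_posSemidef hS hR hQ i) ih x

theorem geom_sum_le_inv {t : ℝ} (h0 : 0 ≤ t) (h1 : t < 1) (i : ℕ) :
    ∑ j ∈ Finset.range i, t ^ j ≤ (1 - t)⁻¹ := by
  rw [← tsum_geometric_of_lt_one h0 h1]
  exact (summable_geometric_of_lt_one h0 h1).sum_le_tsum _ fun j _ => pow_nonneg h0 j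

/-- Under stabilizability, value iteration started at `0` stays bounded. -/
theorem exists_norm_riccati_iterate_zero_le (hAB : Stabilizable A B) (hS : S.PosDef)
    (hR : R.PosDef) :
    ∃ M : ℝ, 0 ≤ M ∧ ∀ i, ‖(fun P => riccati A B R P S)^[i] 0‖ ≤ M := by
  obtain ⟨K, hK⟩ := hAB
  obtain ⟨t, ht, ht1⟩ : ∃ t : ℝ, specRad (A - B * K) < ENNReal.ofReal t ∧ t < 1 := by
    obtain ⟨t, ht0, ht, ht1⟩ := ENNReal.lt_iff_exists_real_btwn.1 hK
    exact ⟨t, ht, by simpa using ht1⟩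
  have ht0 : 0 < t := ENNReal.ofReal_pos.1 (bot_le.trans_lt ht)
  obtain ⟨c, hc, hpow⟩ := exists_norm_pow_le_of_specRad_lt ht
  -- T is the stage cost under the feedback u = Kx, so the sum in `hbound` is the i-step cost of K,
  -- which dominates the optimal one.
  set T := Kᵀ * R * K + S with hT
  have hbound : ∀ (i : ℕ) (x : Fin n → ℝ), ((fun P => riccati A B R P S)^[i] 0).quadForm x ≤
      ∑ j ∈ Finset.range i, T.quadForm ((A - B * K) ^ j *ᵥ x) := by
    intro i
    induction i with
    | zero => intro x; simp
    | succ i ih =>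
      intro x
      rw [Function.iterate_succ_apply', Finset.sum_range_succ']
      have h1 := riccati_quadForm_le (S := S) (A := A) (B := B) hR
        (riccati_iterate_posSemidef (A := A) (B := B) hS hR PosSemidef.zero i) x (K *ᵥ x)
      have h2 := ih ((A - B * K) *ᵥ x)
      simp only [mulVec_mulVec, ← pow_succ] at h2
      simp only [hT, quadForm_add, quadForm_conj, pow_zero, one_mulVec] at h2 ⊢
      rw [mulVec_mulVec, ← sub_mulVec] at h1
      linarith
  have hT : T.PosSemidef :=
    (hR.posSemidef.transpose_mul_mul_same K).add hS.posSemidef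
  have ht2 : t ^ 2 < 1 := by nlinarith
  have h0 : 0 ≤ ‖T‖ * c ^ 2 * (1 - t ^ 2)⁻¹ := by
    have := inv_pos.2 (sub_pos.2 ht2)
    positivity
  refine ⟨‖T‖ * c ^ 2 * (1 - t ^ 2)⁻¹, h0, fun i => ?_⟩
  have hPi := riccati_iterate_posSemidef (A := A) (B := B) hS hR PosSemidef.zero i
  refine hPi.1.l2_opNorm_le h0 fun x => ?_
  have hx := dotProduct_self_nonneg x
  rw [abs_of_nonneg (hPi.quadForm_nonneg x)]
  calc _ ≤ ∑ j ∈ Finset.range i, T.quadForm ((A - B * K) ^ j *ᵥ x) := hbound i x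
    _ ≤ ∑ j ∈ Finset.range i, ‖T‖ * ((c * t ^ j) ^ 2 * (x ⬝ᵥ x)) := by
      refine Finset.sum_le_sum fun j _ => (quadForm_le_norm _ _).trans ?_
      gcongr
      refine (mulVec_dotProduct_self_le _ x).trans ?_
      gcongr
      exact hpow j
    _ = ‖T‖ * c ^ 2 * (∑ j ∈ Finset.range i, (t ^ 2) ^ j) * (x ⬝ᵥ x) := by
      rw [Finset.mul_sum, Finset.sum_mul]
      refine Finset.sum_congr rfl fun j _ => ?_
      rw [← pow_mul, mul_comm 2 j, pow_mul]
      ring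
    _ ≤ _ := by
      gcongr
      exact geom_sum_le_inv (by positivity) ht2 i

/-- The discrete algebraic Riccati equation of a stabilizable pair has a positive definite
solution, the limit of value iteration from `0`. -/
theorem exists_posDef_riccati_eq (hAB : Stabilizable A B) (hS : S.PosDef) (hR : R.PosDef) :
    ∃ P : Matrix (Fin n) (Fin n) ℝ, P.PosDef ∧ riccati A B R P S = P ∧
      ∀ x, S.quadForm x ≤ P.quadForm x := by
  obtain ⟨M, hM0, hM⟩ := exists_norm_riccati_iterate_zero_le hAB hS hR
  obtain ⟨κ, hκ0, hκ1, hκ⟩ := hS.exists_contraction M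
  set f := fun P => riccati A B R P S with hf
  have hpsd : ∀ i, (f^[i] 0).PosSemidef := riccati_iterate_posSemidef hS hR PosSemidef.zero
  have hmono : ∀ i x, (f^[i] 0).quadForm x ≤ (f^[i + 1] 0).quadForm x := by
    intro i x
    rw [Function.iterate_succ_apply]
    exact riccati_iterate_mono hS hR (hpsd 1) PosSemidef.zero
      (by simpa using (hpsd 1).quadForm_nonneg) i x
  -- The start is trivial because 1 - κ⁰ = 0. In the step, `riccati_concave` adds κⁱ S, and S
  -- dominates (1 - κ) times the next iterate: 1 - κⁱ + κⁱ(1 - κ) = 1 - κⁱ⁺¹.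
  have hgeo : ∀ i x, (1 - κ ^ i) * (f^[i + 1] 0).quadForm x ≤ (f^[i] 0).quadForm x := by
    intro i
    induction i with
    | zero => intro x; simp
    | succ i ih =>
      intro x
      have h1 := riccati_concave (A := A) (B := B) (S := S) hR (hpsd i) (hpsd (i + 1))
        (by positivity) (pow_le_one₀ hκ0.le hκ1.le) ih x
      have h2 := mul_le_mul_of_nonneg_left (hκ _ (hM (i + 2)) x) (pow_nonneg hκ0.le i)
      rw [Function.iterate_succ_apply' f (i + 1), Function.iterate_succ_apply' f i] at h2 ⊢
      rw [Function.iterate_succ_apply' f i] at h1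
      simp only [hf] at h1 h2 ⊢
      rw [pow_succ]
      linarith
  have hcauchy : CauchySeq fun i => f^[i] 0 := by
    refine cauchySeq_of_le_geometric κ M hκ1 fun i => ?_
    rw [dist_comm, dist_eq_norm]
    refine ((hpsd _).1.sub (hpsd _).1).l2_opNorm_le (by positivity) fun x => ?_
    rw [quadForm_sub, abs_of_nonneg (sub_nonneg.2 (hmono i x))]
    have h1 := hgeo i x
    have h2 := mul_le_mul_of_nonneg_left
      ((quadForm_le_norm (f^[i + 1] 0) x).trans
        (mul_le_mul_of_nonneg_right (hM (i + 1)) (dotProduct_self_nonneg x)))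
      (pow_nonneg hκ0.le i)
    linarith
  have : CompleteSpace (Matrix (Fin n) (Fin n) ℝ) := FiniteDimensional.complete ℝ _
  obtain ⟨P, hP⟩ := cauchySeq_tendsto_of_complete hcauchy
  have hPpsd : P.PosSemidef := isClosed_posSemidef.mem_of_tendsto hP (.of_forall hpsd)
  have hfix : riccati A B R P S = P := by
    have h1 := (continuousAt_riccati (A := A) (B := B) (S := S) hR hPpsd).tendsto.comp hP
    have h2 := hP.comp (tendsto_add_atTop_nat 1)
    refine tendsto_nhds_unique h1 (h2.congr fun i => ?_)
    exact Function.iterate_succ_apply' f i 0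
  have hSP : ∀ x, S.quadForm x ≤ P.quadForm x := fun x => by
    have := quadForm_le_riccati (A := A) (B := B) (S := S) hR hPpsd x
    rwa [hfix] at this
  exact ⟨P, hPpsd.1.posDef_of_quadForm_le hS hSP, hfix, hSP⟩

/-! ### Stability of the optimal closed loop. -/

/-- The optimal closed loop contracts the quadratic form of a solution of the Riccati equation. -/
theorem exists_quadForm_closedLoop_le (hS : S.PosDef) (hR : R.PosDef) (hP : P.PosSemidef)
    (hfix : riccati A B R P S = P) :
    ∃ κ : ℝ, 0 < κ ∧ κ < 1 ∧ (∀ x, (1 - κ) * P.quadForm x ≤ S.quadForm x) ∧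
      ∀ x, P.quadForm ((A - B * gain A B R P) *ᵥ x) ≤ κ * P.quadForm x := by
  obtain ⟨κ, hκ0, hκ1, hκ⟩ := hS.exists_contraction ‖P‖
  refine ⟨κ, hκ0, hκ1, hκ P le_rfl, fun x => ?_⟩
  have h1 := riccati_quadForm_eq (A := A) (B := B) (S := S) hR hP x
  rw [hfix, mulVec_mulVec, ← sub_mulVec] at h1
  have h2 := hκ P le_rfl x
  have h3 := hR.posSemidef.quadForm_nonneg (gain A B R P *ᵥ x)
  linarith

/-- The optimal closed loop is Schur stable. -/
theorem specRad_closedLoop_lt_one (hS : S.PosDef) (hR : R.PosDef) (hP : P.PosDef)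
    (hfix : riccati A B R P S = P) : specRad (A - B * gain A B R P) < 1 := by
  obtain ⟨κ, hκ0, hκ1, -, hκ⟩ := exists_quadForm_closedLoop_le hS hR hP.posSemidef hfix
  obtain ⟨c, hc, hcP⟩ := hP.exists_quadForm_ge
  set F := A - B * gain A B R P
  have hpow : ∀ i x, P.quadForm (F ^ i *ᵥ x) ≤ κ ^ i * P.quadForm x := by
    intro i
    induction i with
    | zero => intro x; simp
    | succ i ih =>
      intro x
      have h1 := ih (F *ᵥ x)
      rw [mulVec_mulVec, ← pow_succ] at h1
      refine h1.trans ?_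
      rw [pow_succ, mul_assoc]
      exact mul_le_mul_of_nonneg_left (hκ x) (by positivity)
  have hnorm : ∀ i, ‖F ^ i‖ ^ 2 ≤ ‖P‖ / c * κ ^ i := by
    intro i
    refine l2_opNorm_sq_le_of_quadForm (by positivity) fun x => ?_
    have h1 := (hcP (F ^ i *ᵥ x)).trans (hpow i x)
    have h2 := mul_le_mul_of_nonneg_left (quadForm_le_norm P x) (pow_nonneg hκ0.le i)
    rw [div_mul_eq_mul_div, div_mul_eq_mul_div, le_div_iff₀ hc]
    linarith
  apply specRad_lt_one_of_tendsto
  rw [tendsto_zero_iff_norm_tendsto_zero]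
  have h1 : Tendsto (fun i => ‖P‖ / c * κ ^ i) atTop (𝓝 0) := by
    simpa using (tendsto_pow_atTop_nhds_zero_of_lt_one hκ0.le hκ1).const_mul (‖P‖ / c)
  have h2 := squeeze_zero (fun i => sq_nonneg ‖F ^ i‖) hnorm h1
  have h3 := (Real.continuous_sqrt.tendsto 0).comp h2
  simpa [Function.comp_def, Real.sqrt_sq] using h3

/-! ### Two-sided comparison with the closed loop and the convergence rate. -/

/-- Upper comparison of value iteration with the linear dynamics of the optimal closed loop. -/
theorem quadForm_iterate_sub_le (hS : S.PosDef) (hR : R.PosDef) (hP : P.PosSemidef)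
    (hfix : riccati A B R P S = P) (hQ : Q.PosSemidef) (i : ℕ) (x : Fin n → ℝ) :
    ((fun X => riccati A B R X S)^[i] Q - P).quadForm x ≤
      (Q - P).quadForm ((A - B * gain A B R P) ^ i *ᵥ x) := by
  induction i generalizing x with
  | zero => simp
  | succ i ih =>
    have h1 := riccati_quadForm_eq (A := A) (B := B) (S := S) hR hP x
    have h2 := riccati_quadForm_le (A := A) (B := B) (S := S) hR
      (riccati_iterate_posSemidef (A := A) (B := B) hS hR hQ i) x (gain A B R P *ᵥ x)
    have h3 := ih ((A - B * gain A B R P) *ᵥ x)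
    rw [hfix] at h1
    rw [mulVec_mulVec, ← sub_mulVec] at h1 h2
    rw [mulVec_mulVec, ← pow_succ, quadForm_sub] at h3
    rw [quadForm_sub, Function.iterate_succ_apply']
    linarith

/-- One step of value iteration from below: if `(1 - ε) P ≤ Q ≤ P`, the error `P - Q` is
propagated by the optimal closed loop up to a factor `(1 - κ ε)⁻¹`. -/
theorem quadForm_sub_riccati_le (hR : R.PosDef) (hP : P.PosSemidef)
    (hfix : riccati A B R P S = P) (hQ : Q.PosSemidef)
    (hPQ : (P - Q).PosSemidef) {ε κ : ℝ} (hε : 0 < ε) (hε1 : ε ≤ 1) (hκ0 : 0 < κ) (hκ : κ < 1)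
    (hQle : ∀ x, (1 - ε) * P.quadForm x ≤ Q.quadForm x)
    (hB : ∀ u, (1 - κ) * (Bᵀ * P * B + R).quadForm u ≤ R.quadForm u) (x : Fin n → ℝ) :
    P.quadForm x - (riccati A B R Q S).quadForm x ≤
      (1 - κ * ε)⁻¹ * (P - Q).quadForm ((A - B * gain A B R P) *ᵥ x) := by
  set F := A - B * gain A B R P with hF
  set u := gain A B R Q *ᵥ x with hu
  set l := u - gain A B R P *ᵥ x with hl
  have h1 := riccati_quadForm_eq (A := A) (B := B) (S := S) hR hQ x
  have h2 := riccati_complete_square (A := A) (B := B) (S := S) hR hP x u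
  rw [← hu] at h1
  rw [hfix, ← hl] at h2
  have harg : A *ᵥ x - B *ᵥ u = F *ᵥ x - B *ᵥ l := by
    rw [hl, hF, mulVec_sub, sub_mulVec, mulVec_mulVec x B (gain A B R P)]
    abel
  have hκε : κ * ε < 1 := by nlinarith
  have hκε0 : 0 < κ * ε := by positivity
  -- Subtracting `h1` from `h2` gives P(x) - f(Q)(x) = (P - Q)(Fx - Bl) - W(l) with W = R + BᵀPB.
  -- This s makes the second Young coefficient (κε)⁻¹, so that its term is absorbed by W(l): P - Q ≤
  -- εP and BᵀPB ≤ κW.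
  set s := κ * ε / (1 - κ * ε) with hs
  have hs0 : 0 < s := div_pos hκε0 (by linarith)
  have hs1 : 1 + s = (1 - κ * ε)⁻¹ := by
    have : 1 - κ * ε ≠ 0 := by linarith
    rw [hs]; field_simp; ring
  have hs2 : 1 + s⁻¹ = (κ * ε)⁻¹ := by
    have : 1 - κ * ε ≠ 0 := by linarith
    rw [hs, inv_div]; field_simp; ring
  have h3 := hPQ.quadForm_sub_vec_le hs0 (F *ᵥ x) (B *ᵥ l)
  rw [hs1, hs2, ← harg] at h3
  have h4 : (P - Q).quadForm (B *ᵥ l) ≤ κ * ε * (R + Bᵀ * P * B).quadForm l := by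
    have k1 := hQle (B *ᵥ l)
    have k2 := mul_le_mul_of_nonneg_left (hB l) hε.le
    rw [quadForm_add, quadForm_conj] at k2
    rw [quadForm_sub, quadForm_add, quadForm_conj]
    linarith
  have h5 : (κ * ε)⁻¹ * (P - Q).quadForm (B *ᵥ l) ≤ (R + Bᵀ * P * B).quadForm l := by
    rwa [inv_mul_le_iff₀ hκε0]
  rw [quadForm_sub] at h3
  linarith

/-- Lower comparison of value iteration with the linear dynamics of the optimal closed loop,
uniformly over the initial values `(1 - γ) P`. -/
theorem exists_quadForm_sub_iterate_le (hS : S.PosDef) (hR : R.PosDef) (hP : P.PosDef)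
    (hfix : riccati A B R P S = P) :
    ∃ G : ℝ, 0 ≤ G ∧ ∀ γ : ℝ, 0 ≤ γ → γ ≤ 1 → ∀ (i : ℕ) (x : Fin n → ℝ),
      (P - (fun X => riccati A B R X S)^[i] ((1 - γ) • P)).quadForm x ≤
        G * γ * P.quadForm ((A - B * gain A B R P) ^ i *ᵥ x) := by
  obtain ⟨δ, hδ0, hδ1, hδS, -⟩ := exists_quadForm_closedLoop_le hS hR hP.posSemidef hfix
  obtain ⟨κ, hκ0, hκ1, hκ⟩ := hR.exists_contraction ‖Bᵀ * P * B + R‖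
  have hB := hκ _ le_rfl
  set C := κ / (1 - κ) with hC
  have hC0 : 0 ≤ C := div_nonneg hκ0.le (by linarith)
  refine ⟨Real.exp (C * (1 - δ)⁻¹), (Real.exp_pos _).le, fun γ hγ0 hγ1 => ?_⟩
  set f := fun X => riccati A B R X S with hf
  set F := A - B * gain A B R P with hF
  have hQ0 : ((1 - γ) • P).PosSemidef := hP.posSemidef.smul (by linarith)
  have hpsd : ∀ i, (f^[i] ((1 - γ) • P)).PosSemidef := riccati_iterate_posSemidef hS hR hQ0
  have hPfix : ∀ i, f^[i] P = P := Function.iterate_fixed hfix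
  have hle : ∀ i x, (f^[i] ((1 - γ) • P)).quadForm x ≤ P.quadForm x := by
    intro i x
    have := riccati_iterate_mono (A := A) (B := B) hS hR hP.posSemidef hQ0 (fun x => by
      rw [quadForm_smul]
      nlinarith [hP.posSemidef.quadForm_nonneg x]) i x
    rwa [← hf, hPfix] at this
  -- The relative error bound starts at δ⁰ = 1 rather than γ, so the step factors do not depend on
  -- γ.
  have hge : ∀ i x, (1 - δ ^ i) * P.quadForm x ≤ (f^[i] ((1 - γ) • P)).quadForm x := by
    intro i
    induction i with
    | zero => intro x; simpa using hQ0.quadForm_nonneg x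
    | succ i ih =>
      intro x
      have h1 := riccati_concave (A := A) (B := B) (S := S) hR (hpsd i) hP.posSemidef
        (by positivity) (pow_le_one₀ hδ0.le hδ1.le) ih x
      have h2 := mul_le_mul_of_nonneg_left (hδS x) (pow_nonneg hδ0.le i)
      rw [hfix] at h1
      rw [Function.iterate_succ_apply', pow_succ]
      simp only [hf] at h1 h2 ⊢
      linarith
  have hPQ : ∀ i, (P - f^[i] ((1 - γ) • P)).PosSemidef := fun i =>
    (hP.1.sub (hpsd i).1).posSemidef_of_quadForm fun x => by
      rw [quadForm_sub]; linarith [hle i x]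
  -- On [0, 1] the convex function d ↦ (1 - κd)⁻¹ lies below its chord 1 + Cd, hence below exp(Cd).
  -- The product of the factors is then controlled by a geometric sum.
  have hstep : ∀ i, (1 - κ * δ ^ i)⁻¹ ≤ Real.exp (C * δ ^ i) := by
    intro i
    have hd0 : 0 < δ ^ i := pow_pos hδ0 i
    have hd1 : δ ^ i ≤ 1 := pow_le_one₀ hδ0.le hδ1.le
    have h1 : 0 < 1 - κ * δ ^ i := by nlinarith
    have h2 : 0 < 1 - κ := by linarith
    refine le_trans ?_ (Real.add_one_le_exp _)
    rw [inv_le_iff_one_le_mul₀ h1, hC]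
    have : (κ / (1 - κ) * δ ^ i + 1) * (1 - κ * δ ^ i) - 1
        = κ ^ 2 * δ ^ i * (1 - δ ^ i) / (1 - κ) := by
      field_simp; ring
    have h3 : 0 ≤ κ ^ 2 * δ ^ i * (1 - δ ^ i) / (1 - κ) :=
      div_nonneg (mul_nonneg (by positivity) (by linarith)) h2.le
    linarith
  have hmain : ∀ i x, (P - f^[i] ((1 - γ) • P)).quadForm x ≤
      Real.exp (C * ∑ j ∈ Finset.range i, δ ^ j) * γ * P.quadForm (F ^ i *ᵥ x) := by
    intro i
    induction i with
    | zero =>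
      intro x
      simp only [Function.iterate_zero, id, quadForm_sub, quadForm_smul, pow_zero, one_mulVec,
        Finset.range_zero, Finset.sum_empty, mul_zero, Real.exp_zero]
      linarith
    | succ i ih =>
      intro x
      have h1 := quadForm_sub_riccati_le hR hP.posSemidef hfix (hpsd i) (hPQ i) (pow_pos hδ0 i)
        (pow_le_one₀ hδ0.le hδ1.le) hκ0 hκ1 (hge i) hB x
      have h2 := ih (F *ᵥ x)
      rw [mulVec_mulVec, ← pow_succ] at h2
      rw [quadForm_sub, Function.iterate_succ_apply', Finset.sum_range_succ, mul_add,
        Real.exp_add]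
      refine h1.trans ?_
      calc _ ≤ Real.exp (C * δ ^ i) * (Real.exp (C * ∑ j ∈ Finset.range i, δ ^ j) * γ *
            P.quadForm (F ^ (i + 1) *ᵥ x)) :=
            mul_le_mul (hstep i) h2 ((hPQ i).quadForm_nonneg _) (Real.exp_pos _).le
        _ = _ := by ring
  intro i x
  refine (hmain i x).trans ?_
  have := hP.posSemidef.quadForm_nonneg (F ^ i *ᵥ x)
  gcongr
  exact geom_sum_le_inv hδ0.le hδ1 i

/-- Global exponential convergence of value iteration, at every rate above the squared spectral
radius of the optimal closed loop. -/
theorem exists_norm_iterate_sub_le (hS : S.PosDef) (hR : R.PosDef) (hP : P.PosDef)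
    (hfix : riccati A B R P S = P) {θ : ℝ}
    (hθ : specRad (A - B * gain A B R P) < ENNReal.ofReal θ) :
    ∃ α : ℝ, 1 ≤ α ∧ ∀ Q : Matrix (Fin n) (Fin n) ℝ, Q.PosSemidef → ∀ i : ℕ,
      ‖(fun X => riccati A B R X S)^[i] Q - P‖ ≤ α * θ ^ (2 * i) * ‖Q - P‖ := by
  have hθ0 : 0 < θ := ENNReal.ofReal_pos.1 (bot_le.trans_lt hθ)
  obtain ⟨c, hc1, hc⟩ := exists_norm_pow_le_of_specRad_lt hθ
  obtain ⟨μ, hμ0, hμ⟩ := hP.exists_quadForm_ge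
  obtain ⟨G, hG0, hG⟩ := exists_quadForm_sub_iterate_le hS hR hP hfix
  set F := A - B * gain A B R P with hF
  have hFx : ∀ i x, F ^ i *ᵥ x ⬝ᵥ F ^ i *ᵥ x ≤ c ^ 2 * θ ^ (2 * i) * (x ⬝ᵥ x) := by
    intro i x
    refine (mulVec_dotProduct_self_le _ x).trans ?_
    have hx := dotProduct_self_nonneg x
    calc _ ≤ (c * θ ^ i) ^ 2 * (x ⬝ᵥ x) := by gcongr; exact hc i
      _ = _ := by rw [mul_comm 2 i, pow_mul]; ring
  have hH : 0 ≤ G * (‖P‖ / μ) := by positivity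
  -- The summand 1 serves the upper comparison, the summand G‖P‖/μ the lower one.
  refine ⟨c ^ 2 * (1 + G * (‖P‖ / μ)), ?_, fun Q hQ i => ?_⟩
  · nlinarith
  set r := ‖Q - P‖ with hr
  have hr0 : 0 ≤ r := norm_nonneg _
  have hpsd := riccati_iterate_posSemidef (A := A) (B := B) hS hR hQ i
  refine (hpsd.1.sub hP.1).l2_opNorm_le (by positivity) fun x => ?_
  have hx := dotProduct_self_nonneg x
  have hb : 0 ≤ c ^ 2 * θ ^ (2 * i) * (x ⬝ᵥ x) := by positivity
  rw [abs_le]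
  constructor
  -- Since μ|x|² ≤ P(x), one has Q ≥ P - r|x|² ≥ (1 - r/μ)P. Capping at 1 keeps (1 - γ)P positive
  -- semidefinite, and then Q ≥ 0 suffices.
  · set γ := min 1 (r / μ) with hγ
    have hγ0 : 0 ≤ γ := le_min zero_le_one (by positivity)
    have hγ1 : γ ≤ 1 := min_le_left _ _
    have hQ0 : ((1 - γ) • P).PosSemidef := hP.posSemidef.smul (by linarith)
    have h0 : ∀ x, ((1 - γ) • P).quadForm x ≤ Q.quadForm x := by
      intro x
      rw [quadForm_smul]
      rcases le_total 1 (r / μ) with h | h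
      · rw [hγ, min_eq_left h]
        simpa using hQ.quadForm_nonneg x
      · rw [hγ, min_eq_right h]
        have h1 := (abs_le.1 (abs_quadForm_le (Q - P) x)).1
        rw [quadForm_sub, ← hr] at h1
        have h2 := mul_le_mul_of_nonneg_left (hμ x) (div_nonneg hr0 hμ0.le)
        rw [← mul_assoc, div_mul_cancel₀ _ hμ0.ne'] at h2
        linarith
    have h1 := riccati_iterate_mono (A := A) (B := B) hS hR hQ hQ0 h0 i x
    have h2 := hG γ hγ0 hγ1 i x
    have h3 : G * γ * P.quadForm (F ^ i *ᵥ x) ≤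
        G * (‖P‖ / μ) * r * (c ^ 2 * θ ^ (2 * i) * (x ⬝ᵥ x)) := by
      calc _ ≤ G * (r / μ) * (‖P‖ * (c ^ 2 * θ ^ (2 * i) * (x ⬝ᵥ x))) := by
            have k := (quadForm_le_norm P (F ^ i *ᵥ x)).trans
              (mul_le_mul_of_nonneg_left (hFx i x) (norm_nonneg _))
            refine mul_le_mul ?_ k (hP.posSemidef.quadForm_nonneg _) (by positivity)
            exact mul_le_mul_of_nonneg_left (min_le_right _ _) hG0
        _ = _ := by ring
    rw [quadForm_sub] at h2 ⊢
    nlinarith [mul_nonneg hr0 hb]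
  · have h1 := quadForm_iterate_sub_le (A := A) (B := B) hS hR hP.posSemidef hfix hQ i x
    have h2 := (quadForm_le_norm (Q - P) (F ^ i *ᵥ x)).trans
      (mul_le_mul_of_nonneg_left (hFx i x) (norm_nonneg _))
    rw [← hr] at h2
    have h3 := mul_nonneg (mul_nonneg hH hr0) hb
    rw [← hF] at h1
    linarith

theorem isClassKL_exp {α θ : ℝ≥0} (hα : α ≠ 0) (hθ0 : θ ≠ 0) (hθ : θ < 1) :
    IsClassKL fun r i => α * θ ^ (2 * i) * r := by
  have hsq : θ ^ 2 < 1 := pow_lt_one₀ zero_le hθ two_ne_zero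
  refine ⟨fun i => ⟨by fun_prop, ?_, by simp⟩, fun r => ⟨?_, ?_⟩⟩
  · have : 0 < α * θ ^ (2 * i) := by positivity
    exact fun a b hab => mul_lt_mul_of_pos_left hab this
  · intro i j hij
    have := pow_le_pow_of_le_one zero_le hθ.le (Nat.mul_le_mul_left 2 hij)
    dsimp only
    gcongr
  · have h := (NNReal.tendsto_pow_atTop_nhds_zero_of_lt_one hsq).const_mul α |>.mul_const r
    simpa [pow_mul] using h

end ValueIteration
-- Assembly of the theorem.
theorem theorem4p1 (n m : ℕ)
    (A : Matrix (Fin n) (Fin n) ℝ) (B : Matrix (Fin n) (Fin m) ℝ)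
    (S : Matrix (Fin n) (Fin n) ℝ) (R : Matrix (Fin m) (Fin m) ℝ)
    (hAB : Stabilizable A B) (hS : S.PosDef) (hR : R.PosDef) :
    ∃ Pstar : Matrix (Fin n) (Fin n) ℝ,
      -- the unique positive definite solution of the Riccati equation
      (Pstar.PosDef ∧ riccati A B R Pstar S = Pstar) ∧
      (∀ X : Matrix (Fin n) (Fin n) ℝ, X.PosDef → riccati A B R X S = X → X = Pstar) ∧
      -- the optimal closed loop is Schur stable
      specRad (A - B * gain A B R Pstar) < 1 ∧
      -- exact value iteration is globally exponentially stable on the positive semidefinite cone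
      GloballyExpStable (fun P => riccati A B R P S) {P | P.PosSemidef} Pstar ∧
      -- the rate and its comparison function
      ∀ θ : ℝ, specRad (A - B * gain A B R Pstar) < ENNReal.ofReal θ → θ < 1 →
        ∃ α : ℝ, 1 ≤ α ∧ ∃ β : ℝ≥0 → ℕ → ℝ≥0, IsClassKL β ∧
          (∀ (r : ℝ≥0) (i : ℕ), (β r i : ℝ) = α * θ ^ (2 * i) * r) ∧
          ∀ P : ℕ → Matrix (Fin n) (Fin n) ℝ, IsExactVI A B S R P →
            ∀ i : ℕ, ‖P i - Pstar‖₊ ≤ β ‖P 0 - Pstar‖₊ i := by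
  obtain ⟨P, hP, hfix, -⟩ := exists_posDef_riccati_eq hAB hS hR
  have hstable := specRad_closedLoop_lt_one hS hR hP hfix
  obtain ⟨t, ht0, ht, ht1⟩ := ENNReal.lt_iff_exists_real_btwn.1 hstable
  have ht1 : t < 1 := by simpa using ht1
  have ht0 : 0 < t := ENNReal.ofReal_pos.1 (bot_le.trans_lt ht)
  obtain ⟨a, ha1, ha⟩ := exists_norm_iterate_sub_le hS hR hP hfix ht
  refine ⟨P, ⟨hP, hfix⟩, fun X hX hXfix => ?_, hstable, ?_, fun θ hθ hθ1 => ?_⟩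
  -- Value iteration started at another fixed point X stays there, yet converges to P.
  · have h1 : ∀ i, ‖X - P‖ ≤ a * t ^ (2 * i) * ‖X - P‖ := fun i => by
      have := ha X hX.posSemidef i
      rwa [Function.iterate_fixed (f := fun X => riccati A B R X S) hXfix] at this
    have h2 : Tendsto (fun i : ℕ => a * t ^ (2 * i) * ‖X - P‖) atTop (𝓝 0) := by
      have := (tendsto_pow_atTop_nhds_zero_of_lt_one (sq_nonneg t)
        (by nlinarith : t ^ 2 < 1)).const_mul a |>.mul_const ‖X - P‖
      simpa [pow_mul] using this
    exact sub_eq_zero.1 (norm_le_zero_iff.1 (ge_of_tendsto' h2 h1))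
  · refine ⟨fun X hX => riccati_posSemidef hS hR hX, hP.posSemidef, hfix, a, t ^ 2, by linarith,
      by positivity, by nlinarith, fun X hX i => ?_⟩
    rw [← pow_mul]
    exact ha X hX i
  · have hθ0 : 0 < θ := ENNReal.ofReal_pos.1 (bot_le.trans_lt hθ)
    obtain ⟨α, hα1, hα⟩ := exists_norm_iterate_sub_le hS hR hP hfix hθ
    have hα0 : 0 < α := by linarith
    refine ⟨α, hα1, fun r i => ⟨α, hα0.le⟩ * ⟨θ, hθ0.le⟩ ^ (2 * i) * r,
      isClassKL_exp ?_ ?_ ?_, fun r i => rfl, fun Z hZ i => ?_⟩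
    · exact fun h => hα0.ne' (congrArg NNReal.toReal h)
    · exact fun h => hθ0.ne' (congrArg NNReal.toReal h)
    · exact hθ1
    · have hZi : ∀ i, (fun X => riccati A B R X S)^[i] (Z 0) = Z i := fun i => by
        induction i with
        | zero => rfl
        | succ i ih => rw [Function.iterate_succ_apply', ih, hZ.2]
      have := hα (Z 0) hZ.1 i
      rw [hZi] at this
      exact NNReal.coe_le_coe.1 this
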